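/- Let $p$ be an odd prime, let $F$ be a field of characteristic $p$, and let $L=\bigoplus_{i\ge 1}L_i$ be an infinite-dimensional graded Lie algebra of maximal class over $F$; that is, $\dim L_1=2$, $\dim L_i\le 1$ for $i\ge 2$, and $L$ is generated by $L_1$. For $i\ge 2$ let $C_i=\{u\in L_1 : [L_i,u]=0\}$ be the two-step centralizers. If $C_n$ is the first of them different from $C_2$, then $C_n$ is called the second two-step centralizer and $C_2,\dots,C_n$ is called the first constituent, regarded as having length $n$. The further constituents are the segments $C_{i+1},\dots,C_{i+l}$ with $i\ge 2$, $l\ge 1$, $C_i\ne C_2$, $C_{i+l}\ne C_2$ and $C_j=C_2$ for $i<j<i+l$; such a constituent has length $l$. Suppose that the sequence of constituent lengths of $L$ begins $$2q,\ \underbrace{q,\dots,q}_{m},\ 2q-p^{\beta},$$ where $q\ge 1$, $m\ge 0$, $\beta\ge 0$ are integers with $p^{\beta}<q$, and that no two-step centralizer other than the first two, $C_2$ and $C_{2q}$, occurs before the constituent of length $2q-p^\beta$; that is, $C_i\in\{C_2,C_{2q}\}$ for $2\le i\le 2q+mq$. Then $m=p^{k}-2$ for some integer $k\ge 0$. -/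

import Mathlib

namespace MaximalClass

section

variable {F L : Type*} [Field F] [LieRing L] [LieAlgebra F L]

/-- The graded Lie algebra `L = ⨁_{i ≥ 1} L_i` (with `L_0 = 0`) is a graded Lie algebra of maximal class:
`dim L_1 = 2`, `dim L_i ≤ 1` for `i ≥ 2`, and `L` is generated by `L_1`. -/
structure IsMaximalClass (𝓛 : ℕ → Submodule F L) [GradedLieAlgebra 𝓛] : Prop where
  zero_eq_bot : 𝓛 0 = ⊥
  rank_one : Module.rank F (𝓛 1) = 2
  rank_le_one : ∀ i : ℕ, 2 ≤ i → Module.rank F (𝓛 i) ≤ 1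
  generated : LieSubalgebra.lieSpan F L (𝓛 1 : Set L) = ⊤

/-- The two-step centralizer `C_i = C_{L_1}(L_i)`. -/
def twoStepCentralizer (𝓛 : ℕ → Submodule F L) (i : ℕ) : Submodule F L where
  carrier := {u | u ∈ 𝓛 1 ∧ ∀ v ∈ 𝓛 i, ⁅v, u⁆ = 0}
  add_mem' := by
    rintro a b ⟨ha, ha'⟩ ⟨hb, hb'⟩
    exact ⟨add_mem ha hb, fun v hv => by rw [lie_add, ha' v hv, hb' v hv, add_zero]⟩
  zero_mem' := ⟨zero_mem _, fun v _ => lie_zero v⟩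
  smul_mem' := by
    rintro c a ⟨ha, ha'⟩
    exact ⟨Submodule.smul_mem _ c ha, fun v hv => by rw [lie_smul, ha' v hv, smul_zero]⟩

/-- `C_2, …, C_n` is the first constituent (by convention, of length `n`): `C_n` is the first
two-step centralizer different from `C_2`. Thus `C_n` is the second two-step centralizer in
order of occurrence. -/
def IsFirstConstituent (𝓛 : ℕ → Submodule F L) (n : ℕ) : Prop :=
  2 < n ∧ twoStepCentralizer 𝓛 n ≠ twoStepCentralizer 𝓛 2 ∧
    ∀ j : ℕ, 2 ≤ j → j < n → twoStepCentralizer 𝓛 j = twoStepCentralizer 𝓛 2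

/-- `C_{i+1}, …, C_{i+l}` is a constituent of length `l`, other than the first one. -/
def IsConstituent (𝓛 : ℕ → Submodule F L) (i l : ℕ) : Prop :=
  2 ≤ i ∧ 0 < l ∧ twoStepCentralizer 𝓛 i ≠ twoStepCentralizer 𝓛 2 ∧
    twoStepCentralizer 𝓛 (i + l) ≠ twoStepCentralizer 𝓛 2 ∧
    ∀ j : ℕ, i < j → j < i + l → twoStepCentralizer 𝓛 j = twoStepCentralizer 𝓛 2

/-- Starting right after `C_i`, there are consecutive constituents with the listed lengths. -/
def ConsecutiveConstituents (𝓛 : ℕ → Submodule F L) : ℕ → List ℕ → Prop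
  | _, [] => True
  | i, l :: ls => IsConstituent 𝓛 i l ∧ ConsecutiveConstituents 𝓛 (i + l) ls

/-- The sequence of constituent lengths begins with the given list. -/
def ConstituentLengthsBegin (𝓛 : ℕ → Submodule F L) : List ℕ → Prop
  | [] => True
  | n :: ls => IsFirstConstituent 𝓛 n ∧ ConsecutiveConstituents 𝓛 n ls

end

end MaximalClass

/-!
Choose `x ∈ C_{2q}` and `y ∈ C_2`, put `z = x + y`, `v_1 = y`, `v_{i+1} = [v_i, z]`, and write
`[v_i, y] = β_i v_{i+1}`. As long as no two-step centralizer contains `z`, the `v_i` are non-zero,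
and `β_i = 0` or `1` according to whether `C_i = C_2` or `C_i = C_{2q}`. With `E` the shift on
sequences, `[v_i, v_{n+1}] = ((1 - E)^n β)_i v_{i+n+1}`, so that anticommutativity and the Jacobi
identity become identities for `β`, which Frobenius, `(1 - E)^{p^k} = 1 - E^{p^k}`, makes tractable
along multiples of `p^k`.

Anticommutativity below degree `3q` says `binom(2q - 1, j) = (-1)^j` in `F` for `j < q`, which by
Lucas forces `q = p^k`. Let `r = m + 2` and let `q + d` be the length of the intermediate
constituent. The Jacobi identity, applied between the entries `β_{rq}` and `β_{(r+1)q+d}` with only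
zeros in between, forces `d` to be even, and anticommutativity then forces `r` to be odd. The
intermediate constituent is found to end in `C_{2q}` as well, and for every `p^n < r` it is followed
by `p^n` constituents of length `q` ending in `C_{2q}`; the bracket `[v_1, v_{Nq+d}]` with
`N = r + 1 + p^n` then yields `binom(r + p^n, r) = 1` in `F`. If `r = p^n u` with `p ∤ u` and
`u > 1`, Lucas evaluates this binomial coefficient to `u + 1`, a contradiction.
-/

namespace MaximalClass

open Finset

section BracketCoeff

variable {R : Type*} [CommRing R]

variable (R) in
/-- The left shift `E` on sequences, `(E β) i = β (i + 1)`. -/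
def shift : Module.End R (ℕ → R) := LinearMap.funLeft R R Nat.succ

@[simp]
theorem shift_apply (β : ℕ → R) (i : ℕ) : shift R β i = β (i + 1) := rfl

@[simp]
theorem shift_pow_apply (n : ℕ) (β : ℕ → R) (i : ℕ) : (shift R ^ n) β i = β (i + n) := by
  induction n generalizing i with
  | zero => rfl
  | succ n ih => rw [pow_succ', Module.End.mul_apply, shift_apply, ih, add_right_comm, add_assoc]

/-- The structure constants of the ladder `v_1 = y`, `v_{i+1} = [v_i, z]` on which `y` acts by
`[v_i, y] = β_i v_{i+1}`: they satisfy `[v_i, v_{n+1}] = bracketCoeff β n i • v_{i+n+1}`. -/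
def bracketCoeff (β : ℕ → R) (n i : ℕ) : R := ((1 - shift R) ^ n) β i

@[simp]
theorem bracketCoeff_zero (β : ℕ → R) (i : ℕ) : bracketCoeff β 0 i = β i := rfl

theorem bracketCoeff_succ (β : ℕ → R) (n i : ℕ) :
    bracketCoeff β (n + 1) i = bracketCoeff β n i - bracketCoeff β n (i + 1) := by
  rw [bracketCoeff, pow_succ']
  rfl

theorem one_sub_pow_eq_sum {S : Type*} [Ring S] (a : S) (n : ℕ) :
    (1 - a) ^ n = ∑ k ∈ range (n + 1), ((-1) ^ k * n.choose k : ℤ) • a ^ k := by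
  rw [sub_eq_neg_add, (Commute.one_right (-a)).add_pow]
  refine sum_congr rfl fun k _ => ?_
  rw [neg_pow, one_pow, mul_one, (Nat.cast_commute _ _).symm.eq, zsmul_eq_mul]
  push_cast
  rw [← mul_assoc, (Nat.cast_commute _ _).eq]

theorem bracketCoeff_eq_sum (β : ℕ → R) (n i : ℕ) :
    bracketCoeff β n i = ∑ k ∈ range (n + 1), (-1) ^ k * (n.choose k : R) * β (i + k) := by
  simp only [bracketCoeff, one_sub_pow_eq_sum, LinearMap.sum_apply, Finset.sum_apply,
    LinearMap.smul_apply, Pi.smul_apply, shift_pow_apply]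
  simp

theorem bracketCoeff_eq_single {β : ℕ → R} {n i k : ℕ} (hk : k ≤ n)
    (h : ∀ l ≤ n, l ≠ k → β (i + l) = 0) :
    bracketCoeff β n i = (-1) ^ k * (n.choose k : R) * β (i + k) := by
  rw [bracketCoeff_eq_sum]
  refine sum_eq_single_of_mem k (mem_range_succ_iff.2 hk) fun l hl hlk => ?_
  rw [h l (mem_range_succ_iff.1 hl) hlk, mul_zero]

theorem bracketCoeff_eq_left {β : ℕ → R} {n i : ℕ} (h : ∀ l, 0 < l → l ≤ n → β (i + l) = 0) :
    bracketCoeff β n i = β i := by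
  simpa using bracketCoeff_eq_single n.zero_le fun l hln hl => h l (Nat.pos_of_ne_zero hl) hln

theorem bracketCoeff_eq_right {β : ℕ → R} {n i : ℕ} (h : ∀ l < n, β (i + l) = 0) :
    bracketCoeff β n i = (-1) ^ n * β (i + n) := by
  simpa using bracketCoeff_eq_single le_rfl fun l hln hl => h l (lt_of_le_of_ne hln hl)

section CharP

variable {p : ℕ} [Fact p.Prime] [CharP R p]

theorem one_sub_shift_pow_char_pow (k : ℕ) :
    (1 - shift R) ^ p ^ k = 1 - shift R ^ p ^ k := by
  have : CharP (Module.End R (ℕ → R)) p :=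
    charP_of_injective_algebraMap (R := R)
      (fun a b h => by simpa using congrFun (LinearMap.congr_fun h 1) 0) p
  rw [sub_pow_char_pow_of_commute _ _ (Commute.one_left _), one_pow]

theorem bracketCoeff_mul_char_pow_add (β : ℕ → R) (k M c i : ℕ) :
    bracketCoeff β (M * p ^ k + c) i =
      ∑ t ∈ range (M + 1), (-1) ^ t * (M.choose t : R) * bracketCoeff β c (i + t * p ^ k) := by
  rw [bracketCoeff, pow_add, pow_mul', one_sub_shift_pow_char_pow, one_sub_pow_eq_sum]
  simp only [Module.End.mul_apply, LinearMap.sum_apply, Finset.sum_apply, LinearMap.smul_apply,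
    Pi.smul_apply, ← pow_mul', shift_pow_apply]
  simp [bracketCoeff]

theorem bracketCoeff_char_pow_sub_one (β : ℕ → R) (k i : ℕ) :
    bracketCoeff β (p ^ k - 1) i = ∑ l ∈ range (p ^ k), β (i + l) := by
  set γ : ℕ → R := fun n => -∑ l ∈ range n, β l with hγ
  have hβ : β = (1 - shift R) γ := by
    ext n
    simp [hγ, sum_range_succ]
  have hpow : p ^ k - 1 + 1 = p ^ k := Nat.sub_add_cancel (pow_pos (Fact.out : p.Prime).pos k)
  calc bracketCoeff β (p ^ k - 1) i = ((1 - shift R) ^ p ^ k) γ i := by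
        rw [← hpow, pow_succ, Module.End.mul_apply, ← hβ, bracketCoeff, hpow]
    _ = γ i - γ (i + p ^ k) := by
        rw [one_sub_shift_pow_char_pow, LinearMap.sub_apply, Pi.sub_apply, shift_pow_apply,
          Module.End.one_apply]
    _ = ∑ l ∈ range (p ^ k), β (i + l) := by
        simp [hγ, sum_range_add]

end CharP

end BracketCoeff

section Binomial

variable {p : ℕ}

theorem sum_range_neg_one_pow_mul_choose {R : Type*} [Ring R] (n m : ℕ) :
    ∑ k ∈ range (m + 1), (-1 : R) ^ k * ((n + 1).choose k : R) = (-1) ^ m * (n.choose m : R) := by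
  exact_mod_cast congrArg (Int.cast : ℤ → R)
    (Int.alternating_sum_range_choose_eq_choose (n := n) (m := m))

theorem sum_range_neg_one_pow_mul_choose_self {R : Type*} [Ring R] {n : ℕ} (hn : n ≠ 0) :
    ∑ k ∈ range (n + 1), (-1 : R) ^ k * (n.choose k : R) = 0 := by
  exact_mod_cast congrArg (Int.cast : ℤ → R) (Int.alternating_sum_range_choose_of_ne hn)

theorem exists_eq_prime_pow_of_dvd_choose_two_mul (hp : p.Prime) (hodd : Odd p) {q : ℕ}
    (hq : q ≠ 0) (h : ∀ j, 0 < j → j < q → p ∣ (2 * q).choose j) : ∃ k, q = p ^ k := by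
  have : Fact p.Prime := ⟨hp⟩
  obtain ⟨k, u, hu, hqu⟩ := Nat.exists_eq_pow_mul_and_not_dvd hq p hp.ne_one
  refine ⟨k, (Nat.le_of_dvd (Nat.pos_of_ne_zero hq) ⟨u, hqu⟩).eq_or_lt.resolve_right ?_ |>.symm⟩
  intro hlt
  have lucas : (2 * q).choose (p ^ k) ≡ 2 * u [MOD p] := by
    simpa [hqu, mul_left_comm] using
      Choose.choose_pow_mul_pow_mul_modEq_choose_nat (p := p) (k := k) (a := 2 * u) (b := 1)
  have hdvd : p ∣ 2 * u := (lucas.dvd_iff dvd_rfl).1 (h _ (pow_pos hp.pos k) hlt)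
  exact hu ((Nat.Coprime.dvd_mul_left (hodd.coprime_two_right)).1 hdvd)

theorem exists_eq_prime_pow_of_choose_modEq_one (hp : p.Prime) {r : ℕ} (hr : r ≠ 0)
    (h : ∀ n, p ^ n < r → (r + p ^ n).choose r ≡ 1 [MOD p]) : ∃ n, r = p ^ n := by
  have : Fact p.Prime := ⟨hp⟩
  obtain ⟨n, u, hu, hru⟩ := Nat.exists_eq_pow_mul_and_not_dvd hr p hp.ne_one
  refine ⟨n, (Nat.le_of_dvd (Nat.pos_of_ne_zero hr) ⟨u, hru⟩).eq_or_lt.resolve_right ?_ |>.symm⟩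
  intro hlt
  have lucas : (r + p ^ n).choose r ≡ u + 1 [MOD p] := by
    simpa [hru, mul_add] using
      Choose.choose_pow_mul_pow_mul_modEq_choose_nat (p := p) (k := n) (a := u + 1) (b := u)
  exact hu ((Nat.modEq_zero_iff_dvd).1 (Nat.ModEq.add_right_cancel' 1
    (by simpa using lucas.symm.trans (h n hlt))))

theorem neZero_two_of_odd (R : Type*) [Ring R] [Nontrivial R] [CharP R p] (hodd : Odd p) :
    NeZero (2 : R) :=
  ⟨Ring.two_ne_zero fun h => by
    rw [(ringChar.eq R p).symm.trans h] at hodd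
    exact Nat.not_odd_iff_even.2 even_two hodd⟩

end Binomial

section BracketIdentities

variable {R : Type*} [CommRing R]

/-- The identities in degrees up to `W + 1` satisfied by the structure constants of a ladder:
anticommutativity of `[v_{m+1}, v_{n+1}]`, and the Jacobi identity for `v_i`, `v_{n+1}`, `y`. -/
structure BracketIdentities (β : ℕ → R) (W : ℕ) : Prop where
  antisymm : ∀ m n, m + n + 1 ≤ W → bracketCoeff β n (m + 1) = -bracketCoeff β m (n + 1)
  jacobi : ∀ i n, 1 ≤ i → i + n + 1 ≤ W →
    bracketCoeff β n i * β (i + n + 1) =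
      β i * bracketCoeff β n (i + 1) + β (n + 1) * bracketCoeff β (n + 1) i

namespace BracketIdentities

variable {β : ℕ → R} {W : ℕ}

theorem mono (h : BracketIdentities β W) {V : ℕ} (hVW : V ≤ W) : BracketIdentities β V :=
  ⟨fun m n hmn => h.antisymm m n (hmn.trans hVW),
    fun i n hi hin => h.jacobi i n hi (hin.trans hVW)⟩

theorem choose_two_mul_sub_one [IsDomain R] (h : BracketIdentities β W) {q j : ℕ} (hj : j < q)
    (hW : 2 * q + j ≤ W) (hne : β (2 * q) ≠ 0)
    (hzero : ∀ l, 0 < l → l < 3 * q → l ≠ 2 * q → β l = 0) :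
    ((2 * q - 1).choose j : R) = (-1) ^ j := by
  have hleft : bracketCoeff β j (2 * q) = β (2 * q) :=
    bracketCoeff_eq_left fun l _ _ => hzero _ (by lia) (by lia) (by lia)
  have hright : bracketCoeff β (2 * q - 1) (j + 1) =
      (-1) ^ (2 * q - 1 - j) * ((2 * q - 1).choose j : R) * β (2 * q) := by
    rw [bracketCoeff_eq_single (k := 2 * q - 1 - j) (by lia)
      fun l _ _ => hzero _ (by lia) (by lia) (by lia), Nat.choose_symm (by lia)]
    congr 2
    lia
  have hanti := h.antisymm (2 * q - 1) j (by lia)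
  rw [Nat.sub_add_cancel (by lia), hleft, hright] at hanti
  have hsign : (-1 : R) ^ (2 * q - 1 - j) * (-1) ^ j = -1 := by
    rw [← pow_add, Nat.sub_add_cancel (by lia), Odd.neg_one_pow ⟨q - 1, by lia⟩]
  refine mul_right_cancel₀ hne ?_
  linear_combination (-(-1) ^ j) * hanti + (((2 * q - 1).choose j : R) * β (2 * q)) * hsign

theorem exists_eq_prime_pow [IsDomain R] {p : ℕ} [CharP R p] (hp : p.Prime) (hodd : Odd p) {q : ℕ}
    (hq : q ≠ 0) (h : BracketIdentities β (3 * q - 1)) (hne : β (2 * q) ≠ 0)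
    (hzero : ∀ l, 0 < l → l < 3 * q → l ≠ 2 * q → β l = 0) : ∃ k, q = p ^ k := by
  refine exists_eq_prime_pow_of_dvd_choose_two_mul hp hodd hq fun j hj hjq => ?_
  obtain ⟨j, rfl⟩ := Nat.exists_eq_add_one.2 hj
  rw [← CharP.cast_eq_zero_iff R p, ← Nat.sub_add_cancel (show 1 ≤ 2 * q by lia),
    Nat.choose_succ_succ, Nat.cast_add, h.choose_two_mul_sub_one (by lia) (by lia) hne hzero,
    h.choose_two_mul_sub_one hjq (by lia) hne hzero, pow_succ]
  ring

theorem even_of_isolated [IsDomain R] [NeZero (2 : R)] (h : BracketIdentities β W) {i n : ℕ}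
    (hi : 1 ≤ i) (hW : i + n + 1 ≤ W) (hn : β (n + 1) = 0) (hleft : β i ≠ 0)
    (hright : β (i + n + 1) ≠ 0) (hzero : ∀ l, 0 < l → l ≤ n → β (i + l) = 0) : Even n := by
  by_contra hodd
  have hjacobi := h.jacobi i n hi hW
  rw [hn, zero_mul, add_zero, bracketCoeff_eq_left hzero, bracketCoeff_eq_right,
    add_right_comm i 1 n, (Nat.not_even_iff_odd.1 hodd).neg_one_pow] at hjacobi
  · refine mul_ne_zero two_ne_zero (mul_ne_zero hleft hright) ?_
    linear_combination hjacobi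
  · intro l hl
    rw [add_right_comm, add_assoc]
    exact hzero _ l.succ_pos hl

theorem bracketCoeff_one_right (h : BracketIdentities β W) {n : ℕ} (hn : n + 1 ≤ W) :
    bracketCoeff β n 1 = -β (n + 1) := by
  simpa using h.antisymm 0 n (by simpa using hn)

end BracketIdentities

end BracketIdentities

section Peaks

/-- The positions `2q, 3q, …, rq` followed by `(r + 1)q + d, (r + 2)q + d, …` (for `d < q`): the
ends of constituents of lengths `2q`, then `r - 2` times `q`, then `q + d`, then `q` forever. -/
def peaks (q r d : ℕ) : Set ℕ :=
  {l | l % q = 0 ∧ 2 ≤ l / q ∧ l / q ≤ r ∨ l % q = d ∧ r < l / q}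

theorem mul_add_mem_peaks {q r d h c : ℕ} (hc : c < q) :
    h * q + c ∈ peaks q r d ↔ c = 0 ∧ 2 ≤ h ∧ h ≤ r ∨ c = d ∧ r < h := by
  have hdiv : (h * q + c) / q = h := by
    rw [add_comm, Nat.add_mul_div_right _ _ (by lia), Nat.div_eq_of_lt hc, zero_add]
  rw [peaks, Set.mem_ofPred_eq, Nat.mul_add_mod_of_lt hc, hdiv]

/-- The sequence `β` is `1` at the peaks and `0` elsewhere, in positions `1, …, K - 1`. -/
def IsPeakSequence {R : Type*} [Zero R] [One R] (β : ℕ → R) (q r d K : ℕ) : Prop :=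
  Set.EqOn β ((peaks q r d).indicator 1) (Set.Ico 1 K)

namespace IsPeakSequence

variable {R : Type*} {q r d K h : ℕ}

section Values

variable [Zero R] [One R] {β : ℕ → R}

theorem apply_eq_zero (hβ : IsPeakSequence β q r d K) {c : ℕ} (hc : c < q)
    (hpos : 0 < h * q + c) (hK : h * q + c < K) (hcd : c = d → h ≤ r)
    (hc0 : c = 0 → 2 ≤ h → r < h) : β (h * q + c) = 0 := by
  rw [hβ ⟨hpos, hK⟩, Set.indicator_of_notMem]
  rw [mul_add_mem_peaks hc]
  lia

theorem apply_mul_eq_one (hβ : IsPeakSequence β q r d K) (hK : h * q < K) (hq : 0 < q)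
    (hh : 2 ≤ h) (hr : h ≤ r) : β (h * q) = 1 := by
  rw [hβ ⟨Nat.mul_pos (by lia) hq, hK⟩, Set.indicator_of_mem, Pi.one_apply]
  exact (mul_add_mem_peaks (c := 0) hq).2 (Or.inl ⟨rfl, hh, hr⟩)

theorem apply_mul_eq_zero (hβ : IsPeakSequence β q r d K) (hK : h * q < K) (hd : 0 < d)
    (hdq : d < q) (hpos : 0 < h) (hh : h < 2 ∨ r < h) : β (h * q) = 0 :=
  hβ.apply_eq_zero (c := 0) (hd.trans hdq) (Nat.mul_pos hpos (hd.trans hdq)) hK (by lia) (by lia)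

theorem apply_mul_add_eq_one (hβ : IsPeakSequence β q r d K) (hK : h * q + d < K) (hd : 0 < d)
    (hdq : d < q) (hr : r < h) : β (h * q + d) = 1 := by
  rw [hβ ⟨by lia, hK⟩, Set.indicator_of_mem, Pi.one_apply]
  exact (mul_add_mem_peaks hdq).2 (Or.inr ⟨rfl, hr⟩)

theorem apply_mul_add_eq_zero (hβ : IsPeakSequence β q r d K) (hK : h * q + d < K) (hd : 0 < d)
    (hdq : d < q) (hr : h ≤ r) : β (h * q + d) = 0 :=
  hβ.apply_eq_zero hdq (by lia) hK (fun _ => hr) (by lia)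

end Values

variable [CommRing R] {β : ℕ → R}

theorem bracketCoeff_mul (hβ : IsPeakSequence β q r d K) (hdq : d < q) (hK : h * q + d ≤ K) :
    bracketCoeff β (d - 1) (h * q) = β (h * q) :=
  bracketCoeff_eq_left fun l hl hld => hβ.apply_eq_zero (by lia) (by lia) (by lia) (by lia) (by lia)

theorem bracketCoeff_mul_add_one (hβ : IsPeakSequence β q r d K) (hd : 0 < d) (hdq : d < q)
    (hK : h * q + d ≤ K) :
    bracketCoeff β (d - 1) (h * q + 1) = (-1) ^ (d - 1) * β (h * q + d) := by
  rw [bracketCoeff_eq_right fun l hl => ?_, add_assoc, Nat.add_sub_cancel' hd]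
  rw [add_assoc]
  exact hβ.apply_eq_zero (by lia) (by lia) (by lia) (by lia) (by lia)

theorem even_of_ne_zero [IsDomain R] [NeZero (2 : R)]
    (hβ : IsPeakSequence β q r d ((r + 1) * q + d)) (hq : Odd q) (hd : 0 < d) (hdq : d < q)
    (hr : 2 ≤ r) (hW : BracketIdentities β ((r + 1) * q + d)) (hne : β ((r + 1) * q + d) ≠ 0) :
    Even d := by
  have hrq : 2 * q ≤ r * q := Nat.mul_le_mul_right q hr
  have hlen : r * q + (q + (d - 1)) + 1 = (r + 1) * q + d := by grind
  have heven : Even (q + (d - 1)) := by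
    refine hW.even_of_isolated (i := r * q) (by lia) hlen.le ?_ ?_ (hlen ▸ hne) fun l hl hln => ?_
    · have := hβ.apply_mul_add_eq_zero (h := 1) (by lia) hd hdq (by lia)
      rwa [one_mul, ← Nat.sub_add_cancel hd, ← add_assoc] at this
    · rw [hβ.apply_mul_eq_one (by lia) (by lia) hr le_rfl]
      exact one_ne_zero
    · rcases lt_or_ge l q with hlq | hlq
      · exact hβ.apply_eq_zero hlq (by lia) (by lia) (by lia) (by lia)
      · obtain ⟨c, rfl⟩ := Nat.exists_eq_add_of_le hlq
        rw [show r * q + (q + c) = (r + 1) * q + c by ring]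
        exact hβ.apply_eq_zero (by lia) (by lia) (by lia) (by lia) (by lia)
  have hodd : Odd (d - 1) := by grind
  grind

theorem exists_eq_prime_pow [IsDomain R] {p : ℕ} [CharP R p] (hp : p.Prime) (hodd : Odd p)
    (hβ : IsPeakSequence β q r d K) (hq : q ≠ 0) (hr : 2 ≤ r) (hK : 3 * q ≤ K)
    (hW : BracketIdentities β K) : ∃ k, q = p ^ k := by
  refine (hW.mono (show 3 * q - 1 ≤ K by lia)).exists_eq_prime_pow hp hodd hq ?_
    fun l hl hlq hne => ?_
  · rw [hβ.apply_mul_eq_one (by lia) (by lia) le_rfl hr]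
    exact one_ne_zero
  · have hdiv := Nat.div_lt_of_lt_mul (mul_comm 3 q ▸ hlq)
    rw [← Nat.div_add_mod' l q] at hne ⊢
    exact hβ.apply_eq_zero (Nat.mod_lt l (by lia)) (by rwa [Nat.div_add_mod'])
      (by rw [Nat.div_add_mod']; lia) (by lia) (by grind)

section CharP

variable {p k : ℕ} [Fact p.Prime] [CharP R p]

theorem sum_choose_mul_apply (hβ : IsPeakSequence β q r d K) (hq : q = p ^ k) (hd : 0 < d)
    (hdq : d < q) (hde : Even d) {N : ℕ} (hN : N * q + d ≤ K)
    (hW : BracketIdentities β (N * q + d)) :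
    ∑ t ∈ range (N + 1), (-1) ^ t * (N.choose t : R) * β (t * q + d) = β (N * q + d) := by
  have hsign : (-1 : R) ^ (d - 1) = -1 := (Nat.Even.sub_odd hd hde odd_one).neg_one_pow
  have hone : bracketCoeff β (N * q + (d - 1)) 1 = -β (N * q + d) := by
    rw [hW.bracketCoeff_one_right (by lia), add_assoc, Nat.sub_add_cancel hd]
  rw [hq, bracketCoeff_mul_char_pow_add, ← hq] at hone
  rw [← neg_inj, ← hone, ← sum_neg_distrib]
  refine sum_congr rfl fun t ht => ?_
  have htN : t * q ≤ N * q := Nat.mul_le_mul_right q (mem_range_succ_iff.1 ht)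
  rw [add_comm 1, hβ.bracketCoeff_mul_add_one hd hdq (by lia), hsign]
  ring

theorem odd_of_ne_zero [IsDomain R] [NeZero (2 : R)]
    (hβ : IsPeakSequence β q r d ((r + 1) * q + d)) (hq : q = p ^ k) (hd : 0 < d) (hdq : d < q)
    (hde : Even d) (hW : BracketIdentities β ((r + 1) * q + d))
    (hne : β ((r + 1) * q + d) ≠ 0) : Odd r := by
  have hsum := hβ.sum_choose_mul_apply hq hd hdq hde le_rfl hW
  rw [sum_range_succ, sum_eq_zero, zero_add, Nat.choose_self] at hsum
  · by_contra hr
    refine mul_ne_zero two_ne_zero hne ?_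
    rw [Odd.neg_one_pow (Nat.not_odd_iff_even.1 hr).add_one] at hsum
    linear_combination -hsum
  · intro t ht
    have htr : t ≤ r := by simpa [Nat.lt_succ_iff] using ht
    have := Nat.mul_le_mul_right q htr
    rw [hβ.apply_mul_add_eq_zero (by lia) hd hdq htr, mul_zero]

theorem cast_choose_eq_one {e : ℕ} (hβ : IsPeakSequence β q r d ((r + 1 + (e + 1)) * q + d))
    (hq : q = p ^ k) (hd : 0 < d) (hdq : d < q) (hde : Even d) (hr : Odd r)
    (hW : BracketIdentities β ((r + 1 + e) * q + d)) : ((r + e).choose r : R) = 1 := by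
  have hlt {t : ℕ} (ht : t ≤ r + 1 + e) : t * q + d < (r + 1 + (e + 1)) * q + d := by
    have := Nat.mul_lt_mul_of_pos_right (show t < r + 1 + (e + 1) by lia) (hd.trans hdq)
    lia
  have hsum := hβ.sum_choose_mul_apply hq hd hdq hde (hlt le_rfl).le hW
  have halt := sum_range_neg_one_pow_mul_choose_self (R := R) (Nat.succ_ne_zero (r + e))
  rw [Nat.succ_eq_add_one, add_right_comm r e 1] at halt
  rw [← sum_range_add_sum_Ico _ (show r + 1 ≤ r + 1 + e + 1 by lia)] at hsum halt
  have hlow : ∑ t ∈ range (r + 1), (-1) ^ t * ((r + 1 + e).choose t : R) * β (t * q + d) = 0 :=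
    sum_eq_zero fun t ht => by
      rw [hβ.apply_mul_add_eq_zero (hlt (by grind)) hd hdq (mem_range_succ_iff.1 ht), mul_zero]
  have hhigh : ∑ t ∈ Ico (r + 1) (r + 1 + e + 1), (-1) ^ t * ((r + 1 + e).choose t : R) *
      β (t * q + d) = ∑ t ∈ Ico (r + 1) (r + 1 + e + 1), (-1) ^ t * ((r + 1 + e).choose t : R) :=
    sum_congr rfl fun t ht => by
      rw [hβ.apply_mul_add_eq_one (hlt (by grind)) hd hdq (by grind), mul_one]
  rw [add_right_comm r 1 e, sum_range_neg_one_pow_mul_choose, hr.neg_one_pow] at halt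
  rw [hlow, hhigh, hβ.apply_mul_add_eq_one (hlt le_rfl) hd hdq (by lia),
    add_right_comm r 1 e] at hsum
  linear_combination hsum - halt

theorem apply_eq_one_of_forall_eq_zero (hβ : IsPeakSequence β q r d ((r + 1) * q + d))
    (hq : q = p ^ k) (hdq : d < q) (hr : 2 ≤ r)
    (hzero : ∀ l, (r + 1) * q + d < l → l ≤ (r + 2) * q → β l = 0)
    (hW : BracketIdentities β ((r + 2) * q)) : β ((r + 1) * q + d) = 1 := by
  have hrq : 2 * q ≤ r * q := Nat.mul_le_mul_right q hr
  have hr1 : (r + 1) * q = r * q + q := by ring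
  have hr2 : (r + 2) * q = r * q + 2 * q := by ring
  have hleft : ∑ l ∈ range q, β (r * q + l) = 1 := by
    rw [sum_eq_single_of_mem 0 (mem_range.2 (by lia)) fun l hl hl0 => ?_]
    · exact hβ.apply_mul_eq_one (by lia) (by lia) hr le_rfl
    · rw [mem_range] at hl
      exact hβ.apply_eq_zero hl (by lia) (by lia) (by lia) (by lia)
  have hright : ∑ l ∈ range q, β ((r + 1) * q + l) = β ((r + 1) * q + d) := by
    refine sum_eq_single_of_mem d (mem_range.2 hdq) fun l hl hld => ?_
    rw [mem_range] at hl
    rcases lt_or_gt_of_ne hld with hlt | hgt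
    · exact hβ.apply_eq_zero hl (by lia) (by lia) (by lia) (by lia)
    · exact hzero _ (by lia) (by lia)
  have hbracket : bracketCoeff β (2 * q - 1) (r * q) = 1 - β ((r + 1) * q + d) := by
    rw [show 2 * q - 1 = 1 * p ^ k + (p ^ k - 1) by lia, bracketCoeff_mul_char_pow_add,
      sum_range_succ, sum_range_one, bracketCoeff_char_pow_sub_one, bracketCoeff_char_pow_sub_one]
    simp [← hq, ← hr1, hleft, hright, sub_eq_add_neg]
  have hjacobi := hW.jacobi (r * q) (2 * q - 1) (by lia) (by lia)
  rw [show r * q + (2 * q - 1) + 1 = (r + 2) * q by lia, Nat.sub_add_cancel (by lia),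
    hzero ((r + 2) * q) (by lia) le_rfl, mul_zero, hβ.apply_mul_eq_one (by lia) (by lia) hr le_rfl,
    hβ.apply_mul_eq_one (by lia) (by lia) le_rfl hr, one_mul, one_mul] at hjacobi
  have hsucc := bracketCoeff_succ β (2 * q - 1) (r * q)
  rw [Nat.sub_add_cancel (by lia)] at hsucc
  linear_combination hjacobi + hsucc + hbracket

theorem bracketCoeff_mul_add_sub_one (hq : q = p ^ k) (hd : 0 < d) (hdq : d < q) {l s e : ℕ}
    (hl : 2 ≤ l) (hβ : IsPeakSequence β q (l + s) d ((l + s + 1 + e) * q + d)) :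
    bracketCoeff β ((s + e + 1) * q + (d - 1)) (l * q) = (-1) ^ s * ((s + e).choose s : R) := by
  have hle {t : ℕ} (ht : t ≤ s + e + 1) : (l + t) * q + d ≤ (l + s + 1 + e) * q + d := by
    have := Nat.mul_le_mul_right q (show l + t ≤ l + s + 1 + e by lia)
    lia
  have hterm : ∀ t ∈ range (s + e + 2), bracketCoeff β (d - 1) (l * q + t * q) =
      if t < s + 1 then 1 else 0 := fun t ht => by
    rw [← add_mul, hβ.bracketCoeff_mul hdq (hle (by grind))]
    have := hle (t := t) (by grind)
    split_ifs with hts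
    · exact hβ.apply_mul_eq_one (by lia) (by lia) (by lia) (by lia)
    · exact hβ.apply_mul_eq_zero (by lia) hd hdq (by lia) (by lia)
  rw [hq, bracketCoeff_mul_char_pow_add, ← hq, ← sum_range_neg_one_pow_mul_choose,
    sum_congr rfl fun t ht => by rw [hterm t ht]]
  simp only [mul_ite, mul_one, mul_zero, ← sum_filter]
  refine sum_congr (by ext; grind) fun _ _ => rfl

theorem bracketCoeff_mul_add_self (hq : q = p ^ k) (hd : 0 < d) (hdq : d < q) (hde : Even d)
    {l s e : ℕ} (hl : 2 ≤ l) (hM : Odd (s + e))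
    (hβ : IsPeakSequence β q (l + s) d ((l + s + 1 + e) * q + d)) :
    bracketCoeff β ((s + e + 1) * q + d) (l * q) = β ((l + s + 1 + e) * q + d) - 1 := by
  set g := β ((l + s + 1 + e) * q + d)
  have hterm : ∀ t ∈ range (s + e + 2), bracketCoeff β d (l * q + t * q) =
      1 + if t = s + e + 1 then g - 1 else 0 := fun t ht => by
    have hle := Nat.mul_le_mul_right q (show l + t ≤ l + s + 1 + e by grind)
    rw [← add_mul, ← Nat.sub_add_cancel hd, bracketCoeff_succ,
      hβ.bracketCoeff_mul hdq (by lia), hβ.bracketCoeff_mul_add_one hd hdq (by lia),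
      (Nat.Even.sub_odd hd hde odd_one).neg_one_pow]
    split_ifs with hts
    · rw [hβ.apply_mul_eq_zero (by lia) hd hdq (by lia) (by lia),
        show (l + t) * q + d = (l + s + 1 + e) * q + d by grind]
      ring
    · have hlt := Nat.mul_lt_mul_of_pos_right (show l + t < l + s + 1 + e by grind)
        (hd.trans hdq)
      rcases le_or_gt t s with hs | hs
      · rw [hβ.apply_mul_eq_one (by lia) (by lia) (by lia) (by lia),
          hβ.apply_mul_add_eq_zero (by lia) hd hdq (by lia)]
        ring
      · rw [hβ.apply_mul_eq_zero (by lia) hd hdq (by lia) (by lia),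
          hβ.apply_mul_add_eq_one (by lia) hd hdq (by lia)]
        ring
  rw [hq, bracketCoeff_mul_char_pow_add, ← hq, sum_congr rfl fun t ht => by rw [hterm t ht]]
  simp [mul_add, sum_add_distrib, sum_range_neg_one_pow_mul_choose_self, hM.add_one.neg_one_pow]

theorem apply_eq_one_of_choose_ne [IsDomain R] (hq : q = p ^ k) (hd : 0 < d) (hdq : d < q)
    (hde : Even d) {l s e : ℕ} (hl : 2 ≤ l) (hel : e < l) (hM : Odd (s + e))
    (hne : (-1) ^ s * ((s + e).choose s : R) ≠ -1)
    (hβ : IsPeakSequence β q (l + s) d ((l + s + 1 + e) * q + d))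
    (hW : BracketIdentities β ((l + s + 1 + e) * q + d)) : β ((l + s + 1 + e) * q + d) = 1 := by
  have hle := Nat.mul_le_mul_right q (show 2 ≤ l by lia)
  have hjacobi := hW.jacobi (l * q) ((s + e + 1) * q + (d - 1)) (by lia) (by lia)
  rw [show l * q + ((s + e + 1) * q + (d - 1)) + 1 = (l + s + 1 + e) * q + d by lia,
    add_assoc _ (d - 1), Nat.sub_add_cancel hd,
    hβ.apply_mul_add_eq_zero (h := s + e + 1) (by lia) hd hdq (by lia), zero_mul, add_zero,
    hβ.apply_mul_eq_one (by lia) (by lia) hl (by lia), one_mul] at hjacobi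
  have hsucc := bracketCoeff_succ β ((s + e + 1) * q + (d - 1)) (l * q)
  rw [add_assoc _ (d - 1), Nat.sub_add_cancel hd, bracketCoeff_mul_add_self hq hd hdq hde hl hM hβ]
    at hsucc
  rw [bracketCoeff_mul_add_sub_one hq hd hdq hl hβ] at hjacobi hsucc
  refine sub_eq_zero.1 ((mul_eq_zero.1 ?_).resolve_right (sub_ne_zero.2 hne))
  linear_combination hjacobi + hsucc

theorem apply_eq_one_of_le_char_pow [IsDomain R] (hodd : Odd p) (hq : q = p ^ k) (hd : 0 < d)
    (hdq : d < q) (hde : Even d) {n e : ℕ} (hn : p ^ n < r) (he : 0 < e) (hen : e ≤ p ^ n)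
    (hβ : IsPeakSequence β q r d ((r + 1 + e) * q + d))
    (hW : BracketIdentities β ((r + 1 + e) * q + d)) : β ((r + 1 + e) * q + d) = 1 := by
  have hpn : Odd (p ^ n) := hodd.pow
  rcases Nat.even_or_odd e with heven | hodd_e
  · have hlt : e < p ^ n := lt_of_le_of_ne hen fun h => by grind
    obtain ⟨s, hs⟩ := Nat.exists_eq_add_of_lt hlt
    obtain ⟨l, rfl⟩ := Nat.exists_eq_add_of_le' (show s + 1 ≤ r by lia)
    refine apply_eq_one_of_choose_ne hq hd hdq hde (s := s + 1) (by grind) (by lia) (by grind) ?_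
      hβ hW
    have hzero : (((s + 1 + e).choose (s + 1) : ℕ) : R) = 0 := by
      rw [CharP.cast_eq_zero_iff R p, show s + 1 + e = p ^ n by lia]
      exact (Fact.out : p.Prime).dvd_choose_pow (by lia) (by lia)
    simp [hzero]
  · have := neZero_two_of_odd R hodd
    refine apply_eq_one_of_choose_ne hq hd hdq hde (s := 0) (l := r) (by lia) (by lia)
      (by simpa using hodd_e) ?_ hβ hW
    simpa [Ne, eq_neg_iff_add_eq_zero, one_add_one_eq_two] using two_ne_zero (α := R)

end CharP

end IsPeakSequence

end Peaks

section Centralizers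

variable {F L : Type*} [Field F] [LieRing L] [LieAlgebra F L]

theorem lie_lie_right (a b c : L) : ⁅a, ⁅b, c⁆⁆ = ⁅⁅a, b⁆, c⁆ - ⁅⁅a, c⁆, b⁆ := by
  rw [leibniz_lie, ← lie_skew ⁅a, c⁆ b]
  abel

theorem eq_top_of_lieSpan_eq_top {S : Set L} (hS : LieSubalgebra.lieSpan F L S = ⊤)
    {K : Submodule F L} (hSK : S ⊆ K) (hK : ∀ k ∈ K, ∀ u ∈ S, ⁅k, u⁆ ∈ K) : K = ⊤ := by
  have hspan (u : L) : u ∈ LieSubalgebra.lieSpan F L S := hS ▸ LieSubalgebra.mem_top u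
  have hlie (u : L) : ∀ k ∈ K, ⁅k, u⁆ ∈ K := by
    induction hspan u using LieSubalgebra.lieSpan_induction with
    | mem u hu => exact fun k hk => hK k hk u hu
    | zero => exact fun k _ => by rw [lie_zero]; exact K.zero_mem
    | add a b _ _ ha hb => exact fun k hk => by rw [lie_add]; exact K.add_mem (ha k hk) (hb k hk)
    | smul c a _ ha => exact fun k hk => by rw [lie_smul]; exact K.smul_mem c (ha k hk)
    | lie a b _ _ ha hb =>
      exact fun k hk => by
        rw [lie_lie_right]
        exact K.sub_mem (hb _ (ha k hk)) (ha _ (hb k hk))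
  refine K.eq_top_iff'.2 fun u => ?_
  induction hspan u using LieSubalgebra.lieSpan_induction with
  | mem u hu => exact hSK hu
  | zero => exact K.zero_mem
  | add a b _ _ ha hb => exact K.add_mem ha hb
  | smul c a _ ha => exact K.smul_mem c ha
  | lie a b _ _ ha _ => exact hlie b a ha

variable {𝓛 : ℕ → Submodule F L} [GradedLieAlgebra 𝓛]

theorem lie_mem_succ {i : ℕ} {a u : L} (ha : a ∈ 𝓛 i) (hu : u ∈ 𝓛 1) : ⁅a, u⁆ ∈ 𝓛 (i + 1) :=
  SetLike.GradedBracket.bracket_mem ha hu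

namespace IsMaximalClass

variable {i j s : ℕ}

theorem finiteDimensional (hL : IsMaximalClass 𝓛) (i : ℕ) : FiniteDimensional F (𝓛 i) := by
  rw [FiniteDimensional, ← Module.rank_lt_aleph0_iff]
  match i with
  | 0 => rw [hL.zero_eq_bot, rank_bot]; exact Cardinal.aleph0_pos
  | 1 => rw [hL.rank_one]; exact Cardinal.natCast_lt_aleph0 (n := 2)
  | i + 2 => exact (hL.rank_le_one _ (by lia)).trans_lt Cardinal.one_lt_aleph0

theorem finrank_one (hL : IsMaximalClass 𝓛) : Module.finrank F (𝓛 1) = 2 :=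
  Module.finrank_eq_of_rank_eq (by exact_mod_cast hL.rank_one)

theorem exists_lie_ne_zero (hL : IsMaximalClass 𝓛) (hinf : ¬ FiniteDimensional F L)
    (hi : 1 ≤ i) : ∃ a ∈ 𝓛 i, ∃ u ∈ 𝓛 1, ⁅a, u⁆ ≠ 0 := by
  by_contra! hzero
  let K : Submodule F L := ⨆ j : Fin (i + 1), 𝓛 j
  have hle {j : ℕ} (hj : j ≤ i) : 𝓛 j ≤ K :=
    le_iSup (fun j : Fin (i + 1) => 𝓛 j) ⟨j, Nat.lt_succ_of_le hj⟩
  have hK : K = ⊤ := eq_top_of_lieSpan_eq_top hL.generated (hle hi) fun k hk u hu => by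
    induction hk using Submodule.iSup_induction' with
    | mem j a ha =>
      rcases (Nat.lt_succ_iff.1 j.2).lt_or_eq with hj | hj
      · exact hle hj (lie_mem_succ ha hu)
      · rw [hzero a (hj ▸ ha) u hu]
        exact K.zero_mem
    | zero => simp
    | add a b _ _ ha hb => exact (add_lie a b u).symm ▸ K.add_mem ha hb
  have (j : Fin (i + 1)) : FiniteDimensional F (𝓛 j) := hL.finiteDimensional j
  have hfin : FiniteDimensional F K := Submodule.finiteDimensional_iSup _
  exact hinf (Module.finite_def.2 (hK ▸ (Submodule.fg_iff_finiteDimensional K).2 hfin))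

theorem exists_eq_smul (hL : IsMaximalClass 𝓛) (hi : 2 ≤ i) {v w : L} (hv : v ∈ 𝓛 i)
    (hv0 : v ≠ 0) (hw : w ∈ 𝓛 i) : ∃ c : F, w = c • v := by
  have := hL.finiteDimensional i
  have hspan : Submodule.span F {v} = 𝓛 i :=
    Submodule.eq_of_le_of_finrank_le ((Submodule.span_singleton_le_iff_mem v _).2 hv) (by
      rw [finrank_span_singleton hv0]
      exact Module.finrank_le_of_rank_le (by exact_mod_cast hL.rank_le_one i hi))
  obtain ⟨c, hc⟩ := Submodule.mem_span_singleton.1 (hspan ▸ hw)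
  exact ⟨c, hc.symm⟩

theorem mem_twoStepCentralizer (hL : IsMaximalClass 𝓛) (hi : 2 ≤ i) {v u : L}
    (hv : v ∈ 𝓛 i) (hv0 : v ≠ 0) (hu : u ∈ 𝓛 1) :
    u ∈ twoStepCentralizer 𝓛 i ↔ ⁅v, u⁆ = 0 := by
  refine ⟨fun h => h.2 v hv, fun h => ⟨hu, fun w hw => ?_⟩⟩
  obtain ⟨c, rfl⟩ := hL.exists_eq_smul hi hv hv0 hw
  rw [smul_lie, h, smul_zero]

theorem twoStepCentralizer_lt (hL : IsMaximalClass 𝓛) (hinf : ¬ FiniteDimensional F L)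
    (hi : 1 ≤ i) : twoStepCentralizer 𝓛 i < 𝓛 1 := by
  refine lt_of_le_of_ne (fun u hu => hu.1) fun h => ?_
  obtain ⟨a, ha, u, hu, hau⟩ := hL.exists_lie_ne_zero hinf hi
  exact hau ((h ▸ hu : u ∈ twoStepCentralizer 𝓛 i).2 a ha)

theorem twoStepCentralizer_eq_span (hL : IsMaximalClass 𝓛) (hinf : ¬ FiniteDimensional F L)
    (hi : 1 ≤ i) {u : L} (hu : u ∈ twoStepCentralizer 𝓛 i) (hu0 : u ≠ 0) :
    twoStepCentralizer 𝓛 i = Submodule.span F {u} := by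
  have := hL.finiteDimensional 1
  have hlt := hL.twoStepCentralizer_lt hinf hi
  have := Submodule.finiteDimensional_of_le hlt.le
  have hrank := Submodule.finrank_lt_finrank_of_lt hlt
  rw [hL.finrank_one] at hrank
  refine (Submodule.eq_of_le_of_finrank_le
    ((Submodule.span_singleton_le_iff_mem u _).2 hu) ?_).symm
  rw [finrank_span_singleton hu0]
  lia

theorem twoStepCentralizer_eq_of_mem (hL : IsMaximalClass 𝓛) (hinf : ¬ FiniteDimensional F L)
    (hi : 1 ≤ i) (hj : 1 ≤ j) {u : L} (hu0 : u ≠ 0)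
    (hui : u ∈ twoStepCentralizer 𝓛 i) (huj : u ∈ twoStepCentralizer 𝓛 j) :
    twoStepCentralizer 𝓛 i = twoStepCentralizer 𝓛 j := by
  rw [hL.twoStepCentralizer_eq_span hinf hi hui hu0, hL.twoStepCentralizer_eq_span hinf hj huj hu0]

theorem exists_mem_twoStepCentralizer (hL : IsMaximalClass 𝓛) (hinf : ¬ FiniteDimensional F L)
    (hi : 2 ≤ i) : ∃ u ∈ twoStepCentralizer 𝓛 i, u ≠ 0 := by
  obtain ⟨v, hv, u, hu, hvu⟩ := hL.exists_lie_ne_zero hinf (one_le_two.trans hi)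
  have hv0 : v ≠ 0 := fun h => hvu (by rw [h, zero_lie])
  obtain ⟨b, hb, hbu⟩ : ∃ b ∈ 𝓛 1, b ∉ Submodule.span F {u} := by
    by_contra! hall
    have hrank := Submodule.finrank_mono (show 𝓛 1 ≤ Submodule.span F {u} from hall)
    have hcard := finrank_span_le_card (R := F) ({u} : Set L)
    simp only [Set.toFinset_singleton, card_singleton] at hcard
    rw [hL.finrank_one] at hrank
    lia
  obtain ⟨c, hc⟩ := hL.exists_eq_smul (by lia) (lie_mem_succ hv hu) hvu (lie_mem_succ hv hb)
  refine ⟨b - c • u, ?_, fun h0 => hbu ?_⟩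
  · rw [hL.mem_twoStepCentralizer hi hv hv0 (sub_mem hb ((𝓛 1).smul_mem c hu)), lie_sub, lie_smul,
      hc, sub_self]
  · rw [sub_eq_zero.1 h0]
    exact Submodule.smul_mem _ c (Submodule.mem_span_singleton_self u)

theorem lie_ne_zero (hL : IsMaximalClass 𝓛) (hinf : ¬ FiniteDimensional F L) {x y : L}
    (hx : x ∈ 𝓛 1) (hy : y ∈ 𝓛 1) (hy0 : y ≠ 0) (hxy : x ∉ Submodule.span F {y}) :
    ⁅y, x⁆ ≠ 0 := by
  intro hyx
  have hxy0 : ⁅x, y⁆ = 0 := by rw [← lie_skew, hyx, neg_zero]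
  have := hL.finiteDimensional 1
  have hspan : Submodule.span F {x, y} = 𝓛 1 := by
    refine Submodule.eq_of_le_of_finrank_le
      (Submodule.span_le.2 (Set.insert_subset hx (Set.singleton_subset_iff.2 hy))) ?_
    have hlt : Submodule.span F {y} < Submodule.span F {x, y} :=
      SetLike.lt_iff_le_and_exists.2
        ⟨Submodule.span_mono (by simp), x, Submodule.subset_span (by simp), hxy⟩
    have := FiniteDimensional.span_of_finite F (Set.toFinite {x, y})
    have hrank := Submodule.finrank_lt_finrank_of_lt hlt
    rw [finrank_span_singleton hy0] at hrank
    rwa [hL.finrank_one]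
  obtain ⟨a, ha, u, hu, hau⟩ := hL.exists_lie_ne_zero hinf le_rfl
  rw [← hspan, Submodule.mem_span_pair] at ha hu
  obtain ⟨a1, a2, rfl⟩ := ha
  obtain ⟨u1, u2, rfl⟩ := hu
  exact hau (by simp [hyx, hxy0])

end IsMaximalClass

end Centralizers

section Ladder

variable {F L : Type*} [Field F] [LieRing L] [LieAlgebra F L]

/-- The ladder `v_1 = y`, `v_{i+1} = [v_i, z]` of left-normed brackets; `v_0 = 0` is a dummy
value which makes the index agree with the degree. -/
def ladder (y z : L) : ℕ → L
  | 0 => 0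
  | 1 => y
  | n + 2 => ⁅ladder y z (n + 1), z⁆

theorem ladder_succ (y z : L) {n : ℕ} (hn : 1 ≤ n) : ladder y z (n + 1) = ⁅ladder y z n, z⁆ := by
  obtain ⟨n, rfl⟩ := Nat.exists_eq_add_of_le' hn
  rfl

theorem lie_ladder_succ {y z : L} {W : ℕ} {β : ℕ → F}
    (hβ : ∀ i, 1 ≤ i → i ≤ W → ⁅ladder y z i, y⁆ = β i • ladder y z (i + 1)) (n : ℕ) {i : ℕ}
    (hi : 1 ≤ i) (hW : i + n ≤ W) :
    ⁅ladder y z i, ladder y z (n + 1)⁆ = bracketCoeff β n i • ladder y z (i + n + 1) := by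
  induction n generalizing i with
  | zero => exact hβ i hi hW
  | succ n ih =>
    rw [ladder_succ y z (by lia), lie_lie_right, ih hi (by lia), ← ladder_succ y z hi,
      ih (by lia) (by lia), smul_lie, ← ladder_succ y z (by lia), bracketCoeff_succ, sub_smul,
      add_right_comm i 1 n, add_assoc i n 1]

theorem bracketCoeff_smul_lie_ladder {y z : L} {W : ℕ} {β : ℕ → F}
    (hβ : ∀ i, 1 ≤ i → i ≤ W → ⁅ladder y z i, y⁆ = β i • ladder y z (i + 1)) {i n : ℕ}
    (hi : 1 ≤ i) (hW : i + n ≤ W) :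
    bracketCoeff β n i • ⁅ladder y z (i + n + 1), y⁆ =
      β i • ⁅ladder y z (i + 1), ladder y z (n + 1)⁆ +
        β (n + 1) • ⁅ladder y z i, ladder y z (n + 1 + 1)⁆ := by
  rw [← smul_lie, ← lie_ladder_succ hβ n hi hW, ← smul_lie, ← lie_smul, ← hβ i hi (by lia),
    ← hβ (n + 1) (by lia) (by lia), lie_lie_right (ladder y z i), add_sub_cancel]

theorem bracketIdentities_of_ladder_ne_zero {y z : L} {W : ℕ} {β : ℕ → F}
    (hβ : ∀ i, 1 ≤ i → i ≤ W → ⁅ladder y z i, y⁆ = β i • ladder y z (i + 1))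
    (hne : ∀ i, 1 ≤ i → i ≤ W + 1 → ladder y z i ≠ 0) : BracketIdentities β W where
  antisymm m n hmn := by
    refine smul_left_injective F (hne (m + n + 1 + 1) (by lia) (by lia)) ?_
    have hleft := lie_ladder_succ hβ n (i := m + 1) (by lia) (by lia)
    have hright := lie_ladder_succ hβ m (i := n + 1) (by lia) (by lia)
    rw [← lie_skew, hright, ← neg_smul, add_right_comm n 1 m, add_comm n m,
      add_right_comm m 1 n] at hleft
    exact hleft.symm
  jacobi i n hi hin := by
    refine smul_left_injective F (hne (i + n + 1 + 1) (by lia) (by lia)) ?_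
    have h := bracketCoeff_smul_lie_ladder hβ hi (n := n) (by lia)
    rw [hβ (i + n + 1) (by lia) hin, lie_ladder_succ hβ n (by lia) (by lia),
      lie_ladder_succ hβ (n + 1) hi (by lia), smul_smul, smul_smul, smul_smul,
      add_right_comm i 1 n, ← add_assoc i n 1, ← add_smul] at h
    exact h

variable {𝓛 : ℕ → Submodule F L}

/-- Generators `x ∈ C_s` and `y ∈ C_2` of `L_1` for which the ladder of `y` and `x + y` does not
vanish up to degree `W + 1`, together with the action of `y` on the ladder. The coefficient in
degree `i` encodes `C_i`: it is `0` if `C_i = C_2` and `1` if `C_i = C_s`. -/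
structure AdaptedBasis (𝓛 : ℕ → Submodule F L) (s W : ℕ) where
  x : L
  y : L
  coeff : ℕ → F
  x_mem : x ∈ twoStepCentralizer 𝓛 s
  y_mem : y ∈ twoStepCentralizer 𝓛 2
  ladder_ne_zero : ∀ i, 1 ≤ i → i ≤ W + 1 → ladder y (x + y) i ≠ 0
  lie_y : ∀ i, 1 ≤ i → i ≤ W → ⁅ladder y (x + y) i, y⁆ = coeff i • ladder y (x + y) (i + 1)

namespace AdaptedBasis

variable {s W i : ℕ} (B : AdaptedBasis 𝓛 s W)

theorem y_ne_zero : B.y ≠ 0 := B.ladder_ne_zero 1 le_rfl (by lia)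

theorem bracketIdentities : BracketIdentities B.coeff W :=
  bracketIdentities_of_ladder_ne_zero B.lie_y B.ladder_ne_zero

theorem lie_x (hi : 1 ≤ i) (hiW : i ≤ W) : ⁅ladder B.y (B.x + B.y) i, B.x⁆ =
    (1 - B.coeff i) • ladder B.y (B.x + B.y) (i + 1) := by
  rw [sub_smul, one_smul, ← B.lie_y i hi hiW, ladder_succ _ _ hi, ← lie_sub, add_sub_cancel_right]

theorem x_ne_zero (hW : 1 ≤ W) : B.x ≠ 0 := fun hx => by
  refine B.ladder_ne_zero 2 one_le_two (by lia) ?_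
  rw [ladder_succ _ _ le_rfl, hx, zero_add]
  exact lie_self B.y

theorem coeff_one (hW : 1 ≤ W) : B.coeff 1 = 0 := by
  refine (smul_eq_zero.1 ?_).resolve_right (B.ladder_ne_zero 2 one_le_two (by lia))
  rw [← B.lie_y 1 le_rfl hW]
  exact lie_self B.y

end AdaptedBasis

variable [GradedLieAlgebra 𝓛]

theorem ladder_mem {y z : L} (hy : y ∈ 𝓛 1) (hz : z ∈ 𝓛 1) (n : ℕ) : ladder y z n ∈ 𝓛 n := by
  induction n using ladder.induct with
  | case1 => exact zero_mem _
  | case2 => exact hy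
  | case3 n ih => exact lie_mem_succ ih hz

namespace IsMaximalClass

variable {n s W : ℕ}

theorem ladder_ne_zero (hL : IsMaximalClass 𝓛) {y z : L} (hy : y ∈ 𝓛 1) (hz : z ∈ 𝓛 1)
    (hyz : ⁅y, z⁆ ≠ 0) (hzC : ∀ i, 2 ≤ i → i ≤ W → z ∉ twoStepCentralizer 𝓛 i) {i : ℕ}
    (hi : 1 ≤ i) (hiW : i ≤ W + 1) : ladder y z i ≠ 0 := by
  induction i, hi using Nat.le_induction with
  | base => exact fun hy0 => hyz (by rw [show y = 0 from hy0, zero_lie])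
  | succ i hi ih =>
    rcases hi.eq_or_lt with rfl | hi2
    · exact hyz
    · rw [ladder_succ y z hi]
      exact fun h0 => hzC i hi2 (by lia)
        ((hL.mem_twoStepCentralizer hi2 (ladder_mem hy hz i) (ih (by lia)) hz).2 h0)

theorem exists_add_notMem_twoStepCentralizer [NeZero (2 : F)] (hL : IsMaximalClass 𝓛)
    (hinf : ¬ FiniteDimensional F L) (hs : 2 ≤ s)
    (hne : twoStepCentralizer 𝓛 s ≠ twoStepCentralizer 𝓛 2) (hn : 2 ≤ n) :
    ∃ x ∈ twoStepCentralizer 𝓛 s, ∃ y ∈ twoStepCentralizer 𝓛 2, x ≠ 0 ∧ y ≠ 0 ∧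
      x + y ∉ twoStepCentralizer 𝓛 n := by
  obtain ⟨x, hx, hx0⟩ := hL.exists_mem_twoStepCentralizer hinf hs
  obtain ⟨y, hy, hy0⟩ := hL.exists_mem_twoStepCentralizer hinf le_rfl
  by_cases hadd : x + y ∈ twoStepCentralizer 𝓛 n
  · refine ⟨x, hx, -y, neg_mem hy, hx0, neg_ne_zero.2 hy0, fun hsub => hne ?_⟩
    have hxn : x ∈ twoStepCentralizer 𝓛 n := by
      refine ((twoStepCentralizer 𝓛 n).smul_mem_iff (two_ne_zero (α := F))).1 ?_
      rw [two_smul]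
      simpa [add_add_add_comm] using add_mem hadd hsub
    have hyn : y ∈ twoStepCentralizer 𝓛 n := by simpa using sub_mem hadd hxn
    rw [hL.twoStepCentralizer_eq_of_mem hinf (by lia) (by lia) hx0 hx hxn,
      hL.twoStepCentralizer_eq_of_mem hinf (by lia) (by lia) hy0 hyn hy]
  · exact ⟨x, hx, y, hy, hx0, hy0, hadd⟩

theorem add_notMem_twoStepCentralizer (hL : IsMaximalClass 𝓛) (hinf : ¬ FiniteDimensional F L)
    (hs : 2 ≤ s) (hne : twoStepCentralizer 𝓛 s ≠ twoStepCentralizer 𝓛 2) {x y : L}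
    (hx : x ∈ twoStepCentralizer 𝓛 s) (hy : y ∈ twoStepCentralizer 𝓛 2) (hx0 : x ≠ 0)
    (hy0 : y ≠ 0) {i : ℕ} (hi : twoStepCentralizer 𝓛 i = twoStepCentralizer 𝓛 2 ∨
      twoStepCentralizer 𝓛 i = twoStepCentralizer 𝓛 s) : x + y ∉ twoStepCentralizer 𝓛 i := by
  rcases hi with hi | hi <;> rw [hi] <;> intro hmem <;> refine hne ?_
  · exact hL.twoStepCentralizer_eq_of_mem hinf (by lia) (by lia) hx0 hx
      (by simpa using sub_mem hmem hy)
  · exact hL.twoStepCentralizer_eq_of_mem hinf (by lia) (by lia) hy0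
      (by simpa using sub_mem hmem hx) hy

end IsMaximalClass

theorem IsMaximalClass.nonempty_adaptedBasis [NeZero (2 : F)] (hL : IsMaximalClass 𝓛)
    (hinf : ¬ FiniteDimensional F L) {n s W : ℕ} (hs : 2 ≤ s)
    (hne : twoStepCentralizer 𝓛 s ≠ twoStepCentralizer 𝓛 2) (hn : 2 ≤ n)
    (hC : ∀ i, 2 ≤ i → i ≤ W → i ≠ n → twoStepCentralizer 𝓛 i = twoStepCentralizer 𝓛 2 ∨
      twoStepCentralizer 𝓛 i = twoStepCentralizer 𝓛 s) : Nonempty (AdaptedBasis 𝓛 s W) := by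
  obtain ⟨x, hx, y, hy, hx0, hy0, hxyn⟩ :=
    hL.exists_add_notMem_twoStepCentralizer hinf hs hne hn
  have hxy : x ∉ Submodule.span F {y} := fun hmem => hne <| by
    rw [← hL.twoStepCentralizer_eq_span hinf (by lia) hy hy0] at hmem
    exact hL.twoStepCentralizer_eq_of_mem hinf (by lia) (by lia) hx0 hx hmem
  have hz : x + y ∈ 𝓛 1 := add_mem hx.1 hy.1
  have hladder : ∀ i, 1 ≤ i → i ≤ W + 1 → ladder y (x + y) i ≠ 0 := fun i =>
    hL.ladder_ne_zero hy.1 hz (by simpa using hL.lie_ne_zero hinf hx.1 hy.1 hy0 hxy)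
      fun i hi hiW => by
        rcases eq_or_ne i n with rfl | hin
        · exact hxyn
        · exact hL.add_notMem_twoStepCentralizer hinf hs hne hx hy hx0 hy0 (hC i hi hiW hin)
  have hcoeff (i : ℕ) : ∃ b : F, 1 ≤ i → i ≤ W →
      ⁅ladder y (x + y) i, y⁆ = b • ladder y (x + y) (i + 1) := by
    by_cases hi : 1 ≤ i ∧ i ≤ W
    · obtain ⟨b, hb⟩ := hL.exists_eq_smul (by lia) (ladder_mem hy.1 hz (i + 1))
        (hladder (i + 1) (by lia) (by lia)) (lie_mem_succ (ladder_mem hy.1 hz i) hy.1)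
      exact ⟨b, fun _ _ => hb⟩
    · exact ⟨0, fun h1 hW => absurd ⟨h1, hW⟩ hi⟩
  choose β hβ using hcoeff
  exact ⟨⟨x, y, β, hx, hy, hladder, hβ⟩⟩

namespace AdaptedBasis

variable {s W i n : ℕ} (B : AdaptedBasis 𝓛 s W)

theorem ladder_mem (n : ℕ) : ladder B.y (B.x + B.y) n ∈ 𝓛 n :=
  MaximalClass.ladder_mem B.y_mem.1 (add_mem B.x_mem.1 B.y_mem.1) n

theorem twoStepCentralizer_eq_two_iff (hL : IsMaximalClass 𝓛) (hinf : ¬ FiniteDimensional F L)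
    (hi : 2 ≤ i) (hiW : i ≤ W + 1) : twoStepCentralizer 𝓛 i = twoStepCentralizer 𝓛 2 ↔
      ⁅ladder B.y (B.x + B.y) i, B.y⁆ = 0 := by
  rw [← hL.mem_twoStepCentralizer hi (B.ladder_mem i) (B.ladder_ne_zero i (by lia) hiW) B.y_mem.1]
  exact ⟨fun h => h ▸ B.y_mem, fun h =>
    hL.twoStepCentralizer_eq_of_mem hinf (by lia) (by lia) B.y_ne_zero h B.y_mem⟩

theorem coeff_eq_zero_iff (hL : IsMaximalClass 𝓛) (hinf : ¬ FiniteDimensional F L)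
    (hi : 2 ≤ i) (hiW : i ≤ W) :
    B.coeff i = 0 ↔ twoStepCentralizer 𝓛 i = twoStepCentralizer 𝓛 2 := by
  rw [B.twoStepCentralizer_eq_two_iff hL hinf hi (by lia), B.lie_y i (by lia) hiW, smul_eq_zero,
    or_iff_left (B.ladder_ne_zero (i + 1) (by lia) (by lia))]

theorem coeff_eq_one_iff (hL : IsMaximalClass 𝓛) (hinf : ¬ FiniteDimensional F L) (hs : 1 ≤ s)
    (hi : 2 ≤ i) (hiW : i ≤ W) :
    B.coeff i = 1 ↔ twoStepCentralizer 𝓛 i = twoStepCentralizer 𝓛 s := by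
  have hmem := hL.mem_twoStepCentralizer hi (B.ladder_mem i)
    (B.ladder_ne_zero i (by lia) (by lia)) B.x_mem.1
  rw [B.lie_x (by lia) hiW, smul_eq_zero,
    or_iff_left (B.ladder_ne_zero (i + 1) (by lia) (by lia)), sub_eq_zero, eq_comm] at hmem
  rw [← hmem]
  exact ⟨fun h => hL.twoStepCentralizer_eq_of_mem hinf (by lia) hs (B.x_ne_zero (by lia)) h
    B.x_mem, fun h => h ▸ B.x_mem⟩

theorem twoStepCentralizer_eq_two (hL : IsMaximalClass 𝓛) (hinf : ¬ FiniteDimensional F L)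
    (hi : 1 ≤ i) (hW : i + n = W) (hleft : B.coeff i = 0) (hright : B.coeff (n + 1) = 0)
    (hne : bracketCoeff B.coeff n i ≠ 0) :
    twoStepCentralizer 𝓛 (i + n + 1) = twoStepCentralizer 𝓛 2 := by
  have h := bracketCoeff_smul_lie_ladder B.lie_y hi hW.le
  rw [hleft, hright, zero_smul, zero_smul, add_zero] at h
  exact (B.twoStepCentralizer_eq_two_iff hL hinf (by lia) (by lia)).2
    ((smul_eq_zero.1 h).resolve_left hne)

end AdaptedBasis

theorem IsMaximalClass.twoStepCentralizer_add_eq_two [NeZero (2 : F)] (hL : IsMaximalClass 𝓛)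
    (hinf : ¬ FiniteDimensional F L) {p k q s b : ℕ} [Fact p.Prime] [CharP F p] (hq : q = p ^ k)
    (hs : 2 ≤ s) (hne : twoStepCentralizer 𝓛 s ≠ twoStepCentralizer 𝓛 2) (hqb : q ≤ b)
    (hC : ∀ i, 2 ≤ i → i < b → twoStepCentralizer 𝓛 i = twoStepCentralizer 𝓛 2 ∨
      twoStepCentralizer 𝓛 i = twoStepCentralizer 𝓛 s)
    (hCq : twoStepCentralizer 𝓛 q = twoStepCentralizer 𝓛 2)
    (hgap : ∀ i, 2 ≤ i → b < i + q → i < b → twoStepCentralizer 𝓛 i = twoStepCentralizer 𝓛 2)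
    (hb : twoStepCentralizer 𝓛 b ≠ twoStepCentralizer 𝓛 2) {t : ℕ} (ht : 0 < t) (htq : t < q) :
    twoStepCentralizer 𝓛 (b + t) = twoStepCentralizer 𝓛 2 := by
  induction t using Nat.strong_induction_on with
  | _ t ih =>
    obtain ⟨B⟩ := hL.nonempty_adaptedBasis hinf (n := b) (W := b + t - 1) hs hne (by lia)
      fun i hi hiW hib => by
        rcases lt_or_gt_of_ne hib with hlt | hgt
        · exact hC i hi hlt
        · obtain ⟨u, rfl⟩ := Nat.exists_eq_add_of_lt hgt
          exact Or.inl (ih (u + 1) (by lia) (by lia) (by lia))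
    have hzero (i : ℕ) (hib : b < i + q) (hit : i < b + t) (hne : i ≠ b) : B.coeff i = 0 := by
      rcases Nat.lt_or_ge i 2 with hi | hi
      · rw [show i = 1 by lia, B.coeff_one (by lia)]
      · refine (B.coeff_eq_zero_iff hL hinf hi (by lia)).2 ?_
        rcases lt_or_gt_of_ne hne with hlt | hgt
        · exact hgap i hi hib hlt
        · obtain ⟨u, rfl⟩ := Nat.exists_eq_add_of_lt hgt
          exact ih (u + 1) (by lia) (by lia) (by lia)
    have hwindow : bracketCoeff B.coeff (q - 1) (b + t - q) = B.coeff b := by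
      rw [hq, bracketCoeff_char_pow_sub_one, ← hq,
        sum_eq_single_of_mem (q - t) (mem_range.2 (by lia))
          fun l hl hlt => hzero _ (by lia) (by grind) (by lia),
        show b + t - q + (q - t) = b by lia]
    rw [show b + t = b + t - q + (q - 1) + 1 by lia]
    refine B.twoStepCentralizer_eq_two hL hinf (by lia) (by lia)
      (hzero _ (by lia) (by lia) (by lia)) ?_ ?_
    · rw [Nat.sub_add_cancel (by lia), B.coeff_eq_zero_iff hL hinf (by lia) (by lia), hCq]
    · rw [hwindow, Ne, B.coeff_eq_zero_iff hL hinf (by lia) (by lia)]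
      exact hb

end Ladder

section PeakPattern

variable {F L : Type*} [Field F] [LieRing L] [LieAlgebra F L] {𝓛 : ℕ → Submodule F L}
  {q r d N K : ℕ}

/-- In degrees `2, …, K - 1`, the two-step centralizer is `C_{2q}` at the peaks and `C_2`
elsewhere. -/
structure IsPeakPattern (𝓛 : ℕ → Submodule F L) (q r d K : ℕ) : Prop where
  eq_of_mem : ∀ i, 2 ≤ i → i < K → i ∈ peaks q r d →
    twoStepCentralizer 𝓛 i = twoStepCentralizer 𝓛 (2 * q)
  eq_of_notMem : ∀ i, 2 ≤ i → i < K → i ∉ peaks q r d →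
    twoStepCentralizer 𝓛 i = twoStepCentralizer 𝓛 2

theorem notMem_peaks (hr : r ≤ N) (hd : 0 < d) (hdq : d < q) {i : ℕ} (hi : N * q + d < i)
    (hiN : i < (N + 1) * q + d) : i ∉ peaks q r d := by
  have hmod := Nat.mod_lt i (hd.trans hdq)
  have hdiv := Nat.div_add_mod' i q
  rw [← hdiv, mul_add_mem_peaks hmod]
  have hle : N ≤ i / q := (Nat.le_div_iff_mul_le (by lia)).2 (by lia)
  rcases hle.eq_or_lt with h | h
  · rw [← h] at hdiv ⊢
    lia
  · have h1 : i / q ≤ N + 1 := Nat.le_of_lt_succ ((Nat.div_lt_iff_lt_mul (by lia)).2 (by lia))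
    rw [show i / q = N + 1 by lia] at hdiv ⊢
    lia

namespace IsPeakPattern

theorem eq_or_eq (h : IsPeakPattern 𝓛 q r d K) {i : ℕ} (hi : 2 ≤ i) (hiK : i < K) :
    twoStepCentralizer 𝓛 i = twoStepCentralizer 𝓛 2 ∨
      twoStepCentralizer 𝓛 i = twoStepCentralizer 𝓛 (2 * q) :=
  (em (i ∈ peaks q r d)).symm.imp (h.eq_of_notMem i hi hiK) (h.eq_of_mem i hi hiK)

variable [GradedLieAlgebra 𝓛]

theorem isPeakSequence (h : IsPeakPattern 𝓛 q r d K) (hL : IsMaximalClass 𝓛)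
    (hinf : ¬ FiniteDimensional F L) (hd : 0 < d) (hdq : d < q) {W : ℕ}
    (hKW : K ≤ W + 1) (B : AdaptedBasis 𝓛 (2 * q) W) : IsPeakSequence B.coeff q r d K := by
  rintro i ⟨hi, hiK⟩
  rcases Nat.eq_or_lt_of_le hi with rfl | hi2
  · rw [B.coeff_one (by lia), Set.indicator_of_notMem]
    have hmem := mul_add_mem_peaks (q := q) (r := r) (d := d) (h := 0) (c := 1) (by lia)
    rw [zero_mul, zero_add] at hmem
    lia
  · by_cases hmem : i ∈ peaks q r d
    · rw [Set.indicator_of_mem hmem, Pi.one_apply,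
        B.coeff_eq_one_iff hL hinf (by lia) hi2 (by lia), h.eq_of_mem i hi2 hiK hmem]
    · rw [Set.indicator_of_notMem hmem, B.coeff_eq_zero_iff hL hinf hi2 (by lia),
        h.eq_of_notMem i hi2 hiK hmem]

theorem exists_isPeakSequence [NeZero (2 : F)] (h : IsPeakPattern 𝓛 q r d K)
    (hL : IsMaximalClass 𝓛) (hinf : ¬ FiniteDimensional F L)
    (hne : twoStepCentralizer 𝓛 (2 * q) ≠ twoStepCentralizer 𝓛 2) (hd : 0 < d) (hdq : d < q)
    (hK : 2 ≤ K) : ∃ β : ℕ → F, IsPeakSequence β q r d K ∧ BracketIdentities β K ∧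
      (β K = 0 ↔ twoStepCentralizer 𝓛 K = twoStepCentralizer 𝓛 2) ∧
      (β K = 1 ↔ twoStepCentralizer 𝓛 K = twoStepCentralizer 𝓛 (2 * q)) := by
  obtain ⟨B⟩ := hL.nonempty_adaptedBasis hinf (n := K) (W := K) (by lia) hne hK
    fun i hi hiW hin => h.eq_or_eq hi (lt_of_le_of_ne hiW hin)
  exact ⟨B.coeff, h.isPeakSequence hL hinf hd hdq K.le_succ B, B.bracketIdentities,
    B.coeff_eq_zero_iff hL hinf hK le_rfl, B.coeff_eq_one_iff hL hinf (by lia) hK le_rfl⟩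

variable {p k : ℕ} [Fact p.Prime] [CharP F p]

theorem eq_two_of_lt [NeZero (2 : F)] (h : IsPeakPattern 𝓛 q r d ((N + 1) * q + d))
    (hL : IsMaximalClass 𝓛) (hinf : ¬ FiniteDimensional F L) (hq : q = p ^ k)
    (hne : twoStepCentralizer 𝓛 (2 * q) ≠ twoStepCentralizer 𝓛 2) (hd : 0 < d) (hdq : d < q)
    (hrN : r ≤ N) (hN : twoStepCentralizer 𝓛 ((N + 1) * q + d) ≠ twoStepCentralizer 𝓛 2) {i : ℕ}
    (hi : (N + 1) * q + d < i) (hiN : i < (N + 1) * q + d + q) :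
    twoStepCentralizer 𝓛 i = twoStepCentralizer 𝓛 2 := by
  obtain ⟨t, rfl⟩ := Nat.exists_eq_add_of_lt hi
  refine hL.twoStepCentralizer_add_eq_two hinf hq (by lia) hne (by lia)
    (fun i hi hiN => h.eq_or_eq hi hiN) (h.eq_of_notMem q (by lia) (by lia) ?_)
    (fun i hi hNi hiN => h.eq_of_notMem i hi hiN (notMem_peaks hrN hd hdq (by lia) hiN)) hN
    t.succ_pos (by lia)
  have := mul_add_mem_peaks (r := r) (d := d) (h := 1) (hd.trans hdq)
  rw [one_mul, add_zero] at this
  lia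

theorem succ [NeZero (2 : F)] (h : IsPeakPattern 𝓛 q r d ((N + 1) * q + d))
    (hL : IsMaximalClass 𝓛) (hinf : ¬ FiniteDimensional F L) (hq : q = p ^ k)
    (hne : twoStepCentralizer 𝓛 (2 * q) ≠ twoStepCentralizer 𝓛 2) (hd : 0 < d) (hdq : d < q)
    (hrN : r ≤ N) (hN : twoStepCentralizer 𝓛 ((N + 1) * q + d) = twoStepCentralizer 𝓛 (2 * q)) :
    IsPeakPattern 𝓛 q r d ((N + 2) * q + d) := by
  have hmem : (N + 1) * q + d ∈ peaks q r d := (mul_add_mem_peaks hdq).2 (by lia)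
  refine ⟨fun i hi hiN hi_mem => ?_, fun i hi hiN hi_mem => ?_⟩ <;>
    rcases lt_trichotomy i ((N + 1) * q + d) with hlt | rfl | hgt
  · exact h.eq_of_mem i hi hlt hi_mem
  · exact hN
  · exact absurd hi_mem (notMem_peaks (by lia) hd hdq hgt hiN)
  · exact h.eq_of_notMem i hi hlt hi_mem
  · exact absurd hmem hi_mem
  · exact h.eq_two_of_lt hL hinf hq hne hd hdq hrN (hN ▸ hne) hgt (by lia)

theorem eq_two_mul [NeZero (2 : F)] (h : IsPeakPattern 𝓛 q r d ((r + 1) * q + d))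
    (hL : IsMaximalClass 𝓛) (hinf : ¬ FiniteDimensional F L) (hq : q = p ^ k)
    (hne : twoStepCentralizer 𝓛 (2 * q) ≠ twoStepCentralizer 𝓛 2) (hd : 0 < d) (hdq : d < q)
    (hr : 2 ≤ r) (hlast : twoStepCentralizer 𝓛 ((r + 1) * q + d) ≠ twoStepCentralizer 𝓛 2) :
    twoStepCentralizer 𝓛 ((r + 1) * q + d) = twoStepCentralizer 𝓛 (2 * q) := by
  have hgap {i : ℕ} (hi : (r + 1) * q + d < i) (hiW : i ≤ (r + 2) * q) :
      twoStepCentralizer 𝓛 i = twoStepCentralizer 𝓛 2 :=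
    h.eq_two_of_lt hL hinf hq hne hd hdq le_rfl hlast hi (by lia)
  obtain ⟨B⟩ := hL.nonempty_adaptedBasis hinf (n := (r + 1) * q + d) (W := (r + 2) * q)
    (by lia) hne (by lia) fun i hi hiW hin => by
      rcases lt_or_gt_of_ne hin with hlt | hgt
      · exact h.eq_or_eq hi hlt
      · exact Or.inl (hgap hgt hiW)
  rw [← B.coeff_eq_one_iff hL hinf (by lia) (by lia) (by lia)]
  exact (h.isPeakSequence hL hinf hd hdq (by lia) B).apply_eq_one_of_forall_eq_zero hq
    hdq hr (fun l hl hlW => (B.coeff_eq_zero_iff hL hinf (by lia) hlW).2 (hgap hl hlW))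
    B.bracketIdentities

theorem add_char_pow (hodd : Odd p) (h : IsPeakPattern 𝓛 q r d ((r + 1) * q + d))
    (hL : IsMaximalClass 𝓛) (hinf : ¬ FiniteDimensional F L) (hq : q = p ^ k)
    (hne : twoStepCentralizer 𝓛 (2 * q) ≠ twoStepCentralizer 𝓛 2) (hd : 0 < d) (hdq : d < q)
    (hde : Even d) (hr : 2 ≤ r)
    (hlast : twoStepCentralizer 𝓛 ((r + 1) * q + d) ≠ twoStepCentralizer 𝓛 2) {n : ℕ}
    (hn : p ^ n < r) {e : ℕ} (hen : e ≤ p ^ n) :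
    IsPeakPattern 𝓛 q r d ((r + 1 + (e + 1)) * q + d) := by
  have := neZero_two_of_odd F hodd
  induction e with
  | zero =>
    exact h.succ hL hinf hq hne hd hdq le_rfl (h.eq_two_mul hL hinf hq hne hd hdq hr hlast)
  | succ e ih =>
    have he := ih (by lia)
    obtain ⟨β, hβ, hW, -, hone⟩ :=
      he.exists_isPeakSequence hL hinf hne hd hdq (by nlinarith)
    exact he.succ hL hinf hq hne hd hdq (by lia)
      (hone.1 (hβ.apply_eq_one_of_le_char_pow hodd hq hd hdq hde hn e.succ_pos hen hW))

theorem exists_eq_prime_pow (hodd : Odd p) (h : IsPeakPattern 𝓛 q r d ((r + 1) * q + d))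
    (hL : IsMaximalClass 𝓛) (hinf : ¬ FiniteDimensional F L)
    (hne : twoStepCentralizer 𝓛 (2 * q) ≠ twoStepCentralizer 𝓛 2) (hd : 0 < d) (hdq : d < q)
    (hr : 2 ≤ r) (hlast : twoStepCentralizer 𝓛 ((r + 1) * q + d) ≠ twoStepCentralizer 𝓛 2) :
    ∃ n, r = p ^ n := by
  have := neZero_two_of_odd F hodd
  have hrq := Nat.mul_le_mul_right q (show 3 ≤ r + 1 by lia)
  obtain ⟨β, hβ, hW, hzero, -⟩ :=
    h.exists_isPeakSequence hL hinf hne hd hdq (by lia)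
  have hβne := hzero.not.2 hlast
  obtain ⟨k, hq⟩ := hβ.exists_eq_prime_pow Fact.out hodd (by lia) hr (by lia) hW
  have hde : Even d := hβ.even_of_ne_zero (hq ▸ hodd.pow) hd hdq hr hW hβne
  have hro : Odd r := hβ.odd_of_ne_zero hq hd hdq hde hW hβne
  refine exists_eq_prime_pow_of_choose_modEq_one Fact.out (by lia) fun n hn => ?_
  have hext := h.add_char_pow hodd hL hinf hq hne hd hdq hde hr hlast hn le_rfl
  obtain ⟨γ, hγ, hW, -⟩ := hext.exists_isPeakSequence hL hinf hne hd hdq (by lia)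
  rw [← CharP.natCast_eq_natCast F p, Nat.cast_one]
  exact hγ.cast_choose_eq_one hq hd hdq hde hro (hW.mono (by nlinarith))

end IsPeakPattern

end PeakPattern

section Constituents

variable {F L : Type*} [Field F] [LieRing L] [LieAlgebra F L] {𝓛 : ℕ → Submodule F L} {q d m : ℕ}

theorem consecutiveConstituents_replicate_append {i l : ℕ}
    (h : ConsecutiveConstituents 𝓛 i (List.replicate m q ++ [l])) :
    (∀ t < m, IsConstituent 𝓛 (i + t * q) q) ∧ IsConstituent 𝓛 (i + m * q) l := by
  induction m generalizing i with
  | zero => exact ⟨by simp, by simpa using h.1⟩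
  | succ m ih =>
    rw [List.replicate_succ, List.cons_append] at h
    obtain ⟨hshort, hlast⟩ := ih h.2
    refine ⟨fun t ht => ?_, ?_⟩
    · rcases t with _ | t
      · simpa using h.1
      · rw [add_one_mul, add_comm _ q, ← add_assoc]
        exact hshort t (Nat.lt_of_succ_lt_succ ht)
    · rwa [add_one_mul, add_comm _ q, ← add_assoc]

theorem isPeakPattern_of_isConstituent (hdq : d < q)
    (hinitial : IsFirstConstituent 𝓛 (2 * q))
    (hshort : ∀ t < m, IsConstituent 𝓛 (2 * q + t * q) q)
    (hlast : IsConstituent 𝓛 (2 * q + m * q) (q + d))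
    (hfirst : ∀ i, 2 ≤ i → i ≤ 2 * q + m * q → twoStepCentralizer 𝓛 i = twoStepCentralizer 𝓛 2 ∨
      twoStepCentralizer 𝓛 i = twoStepCentralizer 𝓛 (2 * q)) :
    IsPeakPattern 𝓛 q (m + 2) d ((m + 2 + 1) * q + d) := by
  have hpeak : ∀ t ≤ m, twoStepCentralizer 𝓛 (2 * q + t * q) ≠ twoStepCentralizer 𝓛 2 :=
    fun t ht => by
      rcases ht.lt_or_eq with htm | rfl
      · exact (hshort t htm).2.2.1
      · exact hlast.2.2.1
  have hform (i : ℕ) : i < 2 * q ∨ ∃ t c, c < q ∧ i = 2 * q + t * q + c := by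
    refine (lt_or_ge i (2 * q)).imp_right fun hi => ?_
    exact ⟨(i - 2 * q) / q, (i - 2 * q) % q, Nat.mod_lt _ (by lia), by
      rw [add_assoc, Nat.div_add_mod', Nat.add_sub_cancel' hi]⟩
  have hmem {t c : ℕ} (hc : c < q) : 2 * q + t * q + c ∈ peaks q (m + 2) d ↔
      c = 0 ∧ t ≤ m ∨ c = d ∧ m < t := by
    rw [← add_mul, mul_add_mem_peaks hc]
    lia
  have hlow {i : ℕ} (hi : i < 2 * q) : i ∉ peaks q (m + 2) d := fun hi_mem => by
    have := Nat.div_lt_of_lt_mul (mul_comm 2 q ▸ hi)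
    grind [peaks]
  constructor <;> intro i hi hiK hpeaks <;> rcases hform i with hlt | ⟨t, c, hc, rfl⟩
  · exact absurd hpeaks (hlow hlt)
  · obtain ⟨rfl, htm⟩ | ⟨rfl, htm⟩ := (hmem hc).1 hpeaks
    · exact (hfirst _ hi (by nlinarith)).resolve_left (hpeak t htm)
    · have := Nat.mul_le_mul_right q (Nat.succ_le_of_lt htm)
      lia
  · exact hinitial.2.2 i hi hlt
  · rw [hmem hc] at hpeaks
    rcases lt_trichotomy t m with htm | rfl | htm
    · exact (hshort t htm).2.2.2.2 _ (by lia) (by lia)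
    · exact hlast.2.2.2.2 _ (by lia) (by lia)
    · have := Nat.mul_le_mul_right q (Nat.succ_le_of_lt htm)
      exact hlast.2.2.2.2 _ (by lia) (by lia)

end Constituents

end MaximalClass

open MaximalClass in
theorem mainTheorem7_general {F L : Type*} [Field F] [LieRing L] [LieAlgebra F L]
    (p : ℕ) (hp : p.Prime) (hodd : Odd p) [CharP F p]
    (𝓛 : ℕ → Submodule F L) [GradedLieAlgebra 𝓛] (hL : IsMaximalClass 𝓛)
    (hinf : ¬ FiniteDimensional F L) (q m l : ℕ) (hql : q < l) (hlq : l < 2 * q)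
    (hlen : ConstituentLengthsBegin 𝓛 (2 * q :: (List.replicate m q ++ [l])))
    (hfirst : ∀ i : ℕ, 2 ≤ i → i ≤ 2 * q + m * q →
      twoStepCentralizer 𝓛 i = twoStepCentralizer 𝓛 2 ∨
      twoStepCentralizer 𝓛 i = twoStepCentralizer 𝓛 (2 * q)) :
    ∃ k : ℕ, m + 2 = p ^ k := by
  have : Fact p.Prime := ⟨hp⟩
  obtain ⟨d, rfl⟩ := Nat.exists_eq_add_of_le hql.le
  have hd : 0 < d := by lia
  have hdq : d < q := by lia
  obtain ⟨hinitial, hcons⟩ := hlen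
  obtain ⟨hshort, hlast⟩ := consecutiveConstituents_replicate_append hcons
  have hpattern := isPeakPattern_of_isConstituent hdq hinitial hshort hlast hfirst
  refine hpattern.exists_eq_prime_pow hodd hL hinf hinitial.2.1 hd hdq (by lia) ?_
  rw [show (m + 2 + 1) * q + d = 2 * q + m * q + (q + d) by ring]
  exact hlast.2.2.2.1

/-- The constituents of lengths `2q, q, …, q` (with `m` short ones) comprise `C_2, …, C_{2q+mq}`,
so `hfirst` says that only the first two two-step centralizers `C_2` and `C_{2q}` occur before
the second non-short constituent; `hβ` says that the latter is intermediate, of length strictly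
between `q` and `2q`. -/
theorem mainTheorem7 {F L : Type*} [Field F] [LieRing L] [LieAlgebra F L]
    (p : ℕ) (hp : p.Prime) (hodd : Odd p) [CharP F p]
    (𝓛 : ℕ → Submodule F L) [GradedLieAlgebra 𝓛] (hL : MaximalClass.IsMaximalClass 𝓛)
    (hinf : ¬ FiniteDimensional F L)
    (q m β : ℕ) (hβ : p ^ β < q)
    (hlen : MaximalClass.ConstituentLengthsBegin 𝓛
      (2 * q :: (List.replicate m q ++ [2 * q - p ^ β])))
    (hfirst : ∀ i : ℕ, 2 ≤ i → i ≤ 2 * q + m * q →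
      MaximalClass.twoStepCentralizer 𝓛 i = MaximalClass.twoStepCentralizer 𝓛 2 ∨
      MaximalClass.twoStepCentralizer 𝓛 i = MaximalClass.twoStepCentralizer 𝓛 (2 * q)) :
    ∃ k : ℕ, m + 2 = p ^ k := by
  have hpos : 0 < p ^ β := pow_pos hp.pos β
  exact mainTheorem7_general p hp hodd 𝓛 hL hinf q m _ (by lia) (by lia) hlen hfirst
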